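/- Theorem 3.10 ($\mathbf{KD45}^{\mathbf{as}}=\mathbf{KD45}$). Conventions. Modal formulas are built from variables $p_0,p_1,\dots$ with $\to,\bot,\Box$ (and $\Diamond\varphi=\neg\Box\neg\varphi$). A normal modal logic is a set of formulas that contains all propositional tautologies and $\Box(p\to q)\to(\Box p\to\Box q)$ and is closed under modus ponens, necessitation and substitution. $\mathbf{KD45}$ is the least normal modal logic containing $\Box p\to\Diamond p$, $\Box p\to\Box\Box p$ and $\Diamond p\to\Box\Diamond p$. A frame is a pair $F=(X,R)$ with $X\neq\varnothing$ and $R\subseteq X\times X$; it is connected if any two states are related by $(R\cup R^{-1})^*$, and point-generated if some state $a$ satisfies $\{b : a R^* b\}=X$. For a set $\Gamma$ of formulas, $\mathrm{Fr}\,\Gamma$ is the class of frames in which all formulas of $\Gamma$ are valid, and $\mathrm{Con}\,\mathcal C$ is the class of connected frames of $\mathcal C$. A frame in $\mathrm{Fr}\,\mathbf{KD45}$ is called a $\mathbf{KD45}$-frame. Let $[n]=\{0,\dots,n-1\}$ and let $\mathcal F_n$ be the set of frames with set of states $[n]$, $n\ge 1$. For a class $\mathcal C$ of frames, $\hat F_n(\mathcal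 C)$ is a uniformly distributed random element of $\mathcal F_n\cap\mathcal C$, and a property holds in it a.a.s. if its probability tends to $1$ as $n\to\infty$. For a normal modal logic $L$, $L^{\mathbf{as}}$ is the set of formulas $\varphi$ such that a.a.s. $\varphi$ is valid in $\hat F_n(\mathrm{Fr}\,L)$. A p-morphism from $(X,R)$ to $(Y,S)$ is a surjection $f:X\to Y$ with $\{y: f(a)\,S\,y\}=f(\{b: a\,R\,b\})$ for all $a\in X$. For a Euclidean frame $F=(X,R)$ let $U_F=\{b\in X:\exists a\in X,\ aRb\}$; this is the unique $U\subseteq X$ such that $R\cap(U\times U)$ is an equivalence relation on $U$ and $R\subseteq X\times U$. Statement. 1. $\mathbf{KD45}^{\mathbf{as}}=\mathbf{KD45}$. 2. A frame is a $\mathbf{KD45}$-frame if and only if it is serial, transitive and Euclidean. 3. A Euclidean frame $F=(X,R)$ is serial, transitive and connected if and only if $U_F\neq\varnothing$ and $R=X\times U_F$. 4. For every $n\ge1$, the map $F\mapsto U_F$ is a bijection from $\mathcal F_n\cap\mathrm{Con}\,\mathrm{Fr}\,\mathbf{KD45}$ onto the set of nonempty subsets of $[n]$; hence $|\mathcal F_n\cap\mathrm{Con}\,\mathrm{Fr}\,\mathbf{KD45}|=2^n-1$.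 5. For every fixed $r\in\omega$, a.a.s. $r<|U_{\hat F_n(\mathrm{Con}\,\mathrm{Fr}\,\mathbf{KD45})}|<n$. 6. For every finite point-generated $\mathbf{KD45}$-frame $G$, a.a.s. there is a p-morphism from $\hat F_n(\mathrm{Con}\,\mathrm{Fr}\,\mathbf{KD45})$ onto $G$. -/

import Mathlib

open Filter Topology

universe u v

namespace ModalRandom

/-! ## Modal formulas and normal modal logics -/

/-- Formulas of the basic modal language over the variables `p 0, p 1, …`. -/
inductive Formula : Type
  | var : ℕ → Formula
  | bot : Formula
  | imp : Formula → Formula → Formula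
  | box : Formula → Formula

namespace Formula

/-- Negation, as an abbreviation. -/
def neg (φ : Formula) : Formula := imp φ bot

/-- The diamond, as an abbreviation. -/
def dia (φ : Formula) : Formula := neg (box (neg φ))

/-- `φ.subst p θ` is the result of replacing all occurrences of the variable `p` in `φ` by `θ`. -/
def subst (φ : Formula) (p : ℕ) (θ : Formula) : Formula :=
  match φ with
  | var q => if q = p then θ else var q
  | bot => bot
  | imp α β => imp (subst α p θ) (subst β p θ)
  | box α => box (subst α p θ)

/-- Propositional tautologies: formulas true under every Boolean assignment of truth values,
boxed subformulas being treated as atoms. -/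
def IsTautology (φ : Formula) : Prop :=
  ∀ t : Formula → Prop, ¬ t bot → (∀ α β, t (imp α β) ↔ (t α → t β)) → t φ

/-- The normality axiom `□(p → q) → (□p → □q)`. -/
def axK : Formula :=
  imp (box (imp (var 0) (var 1))) (imp (box (var 0)) (box (var 1)))

/-- The axiom `□p → ◇p`. -/
def axD : Formula := imp (box (var 0)) (dia (var 0))

/-- The axiom `□p → □□p`. -/
def ax4 : Formula := imp (box (var 0)) (box (box (var 0)))

/-- The axiom `◇p → □◇p`. -/
def ax5 : Formula := imp (dia (var 0)) (box (dia (var 0)))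

end Formula

/-- Normal modal logics. -/
structure IsNormalLogic (L : Set Formula) : Prop where
  taut : ∀ φ : Formula, φ.IsTautology → φ ∈ L
  normality : Formula.axK ∈ L
  mp : ∀ φ ψ : Formula, φ ∈ L → Formula.imp φ ψ ∈ L → ψ ∈ L
  gen : ∀ φ : Formula, φ ∈ L → Formula.box φ ∈ L
  sub : ∀ (φ : Formula) (p : ℕ) (θ : Formula), φ ∈ L → φ.subst p θ ∈ L

/-- The logic **KD45**: the least normal modal logic containing the axioms D, 4 and 5. -/
def KD45 : Set Formula :=
  ⋂₀ {L | IsNormalLogic L ∧ Formula.axD ∈ L ∧ Formula.ax4 ∈ L ∧ Formula.ax5 ∈ L}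

/-! ## Kripke frames -/

/-- Kripke frames with a nonempty set of states. -/
structure Frame : Type (u + 1) where
  State : Type u
  nonempty : Nonempty State
  R : State → State → Prop

/-- Truth of a formula at a state of the model `(X, R, V)`. -/
def Sat {X : Type u} (R : X → X → Prop) (V : ℕ → X → Prop) : Formula → X → Prop
  | Formula.var p, a => V p a
  | Formula.bot, _ => False
  | Formula.imp φ ψ, a => Sat R V φ a → Sat R V ψ a
  | Formula.box φ, a => ∀ b, R a b → Sat R V φ b

/-- The set of states that have a predecessor; for a Euclidean relation this is the set `U_F`,
see `eq_finalCluster_iff`. -/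
def finalCluster {X : Type u} (R : X → X → Prop) : Set X := {b | ∃ a, R a b}

namespace Frame

/-- Validity of a formula in a frame. -/
def Valid (F : Frame.{u}) (φ : Formula) : Prop :=
  ∀ (V : ℕ → F.State → Prop) (a : F.State), Sat F.R V φ a

def Serial (F : Frame.{u}) : Prop := ∀ a, ∃ b, F.R a b

def Transitive (F : Frame.{u}) : Prop := ∀ a b c, F.R a b → F.R b c → F.R a c

def Euclidean (F : Frame.{u}) : Prop := ∀ a b c, F.R a b → F.R a c → F.R b c

/-- The frame (whose domain is nonempty) has exactly one connected component: any two states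
are related by the reflexive transitive closure of `R ∪ R⁻¹`. -/
def Connected (F : Frame.{u}) : Prop :=
  ∀ a b, Relation.ReflTransGen (fun x y => F.R x y ∨ F.R y x) a b

/-- The frame is generated by one of its states. -/
def PointGenerated (F : Frame.{u}) : Prop :=
  ∃ a, ∀ b, Relation.ReflTransGen F.R a b

/-- p-morphisms from `F` to `G`: surjective maps with `S_out (f a) = f (R_out a)`. -/
def IsPMorphism (F : Frame.{u}) (G : Frame.{v}) (f : F.State → G.State) : Prop :=
  Function.Surjective f ∧ ∀ a, {y | G.R (f a) y} = f '' {b | F.R a b}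

end Frame

/-- In a Euclidean frame, `finalCluster` is the unique set `U` of states such that `R` restricts
to an equivalence relation on `U` and `R ⊆ X × U`. -/
theorem eq_finalCluster_iff (F : Frame.{u}) (hF : F.Euclidean) (U : Set F.State) :
    (Equivalence (fun x y : U => F.R x y) ∧ ∀ a b, F.R a b → b ∈ U) ↔
      U = finalCluster F.R := by
  constructor
  · rintro ⟨h, hU⟩
    ext b
    exact ⟨fun hb => ⟨b, h.refl ⟨b, hb⟩⟩, fun ⟨a, ha⟩ => hU a b ha⟩
  · rintro rfl
    have hr : ∀ x : finalCluster F.R, F.R x x := fun ⟨x, a, ha⟩ => hF a x x ha ha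
    exact ⟨⟨hr, fun {x y} h => hF _ _ _ h (hr x),
      fun {x y z} h h' => hF _ _ _ (hF _ _ _ h (hr x)) h'⟩, fun a b h => ⟨a, h⟩⟩

/-- The class of all frames validating every formula of `Γ`. -/
def Fr (Γ : Set Formula) : Set Frame.{u} := {F | ∀ φ ∈ Γ, F.Valid φ}

/-- The connected frames of a class. -/
def ConFrames (C : Set Frame.{u}) : Set Frame.{u} := {F | F ∈ C ∧ F.Connected}

/-! ## Random frames -/

/-- The frames of the class `C` whose set of states is `[n] = {0, …, n - 1}`, each given by its
relation; there are none for `n = 0`, as frames are nonempty. -/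
def labelled (C : Set Frame.{0}) (n : ℕ) : Set (Fin n → Fin n → Prop) :=
  {R | ∃ h : Nonempty (Fin n), (⟨Fin n, h, R⟩ : Frame.{0}) ∈ C}

/-- The probability that the uniformly distributed random element of the set of `C`-frames on `[n]`
belongs to `A`. -/
noncomputable def prob (C : Set Frame.{0}) (n : ℕ) (A : Set Frame.{0}) : ℝ :=
  ((labelled (C ∩ A) n).ncard : ℝ) / ((labelled C n).ncard : ℝ)

/-- The random `C`-frame on `[n]` belongs to `Q n` asymptotically almost surely. -/
def AAS (C : Set Frame.{0}) (Q : ℕ → Set Frame.{0}) : Prop :=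
  Tendsto (fun n => prob C n (Q n)) atTop (𝓝 1)

/-- The logic of almost sure validities of a class of frames. -/
def LogAS (C : Set Frame.{0}) : Set Formula := {φ | AAS C (fun _ => {F | F.Valid φ})}

/-- `L^as` for a normal modal logic `L`. -/
def almostSure (L : Set Formula) : Set Formula := LogAS (Fr L)

end ModalRandom

open ModalRandom

/-! A KD45-frame is a disjoint union of components, each consisting of a final cluster `U` together
with states outside `U` that see exactly `U`. Within a component all states have the same
successors, which is the form `IsKD` in which frames are counted.

Soundness gives one inclusion of the main claim. For the other, a non-theorem is refuted at a root
over a finite cluster carrying `k` valuations (canonical model, then truncation to finitely many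
variables: `exists_finite_not_coneSat`). Such a refutation transfers to any irreflexive state with
at least `k` successors, by spreading the valuations over these successors
(`not_valid_of_not_coneSat`). It is not necessary that almost all frames have such a state; a
positive proportion suffices. This is `ncard_not_hasCone_le`: near `2 * k` marked points, a relation
without a large irreflexive cone is altered so that it acquires one, and a code from a set whose
size depends only on `k` allows the alteration to be undone. Hence the probability of validity stays
bounded away from 1.

A connected KD45-frame has a single component, so it amounts to a nonempty subset of `[n]`. A random
nonempty subset is proper and has more than `r` elements a.a.s., since only polynomially many
subsets have at most `r` elements. A large proper final cluster can be mapped onto the cluster of a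
given point-generated frame, with a state left over for the root. -/

namespace ModalRandom

/-! ## Frame conditions -/

namespace Formula

/-- All variables of the formula have index less than `N`. -/
def VarsBelow (N : ℕ) : Formula → Prop
  | var p => p < N
  | bot => True
  | imp α β => VarsBelow N α ∧ VarsBelow N β
  | box α => VarsBelow N α

theorem VarsBelow.mono {N M : ℕ} (h : N ≤ M) {φ : Formula} (hφ : φ.VarsBelow N) :
    φ.VarsBelow M := by
  induction φ with
  | var p => exact lt_of_lt_of_le hφ h
  | bot => trivial
  | imp α β iα iβ => exact ⟨iα hφ.1, iβ hφ.2⟩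
  | box α iα => exact iα hφ

theorem exists_varsBelow (φ : Formula) : ∃ N, φ.VarsBelow N := by
  induction φ with
  | var p => exact ⟨p + 1, Nat.lt_succ_self p⟩
  | bot => exact ⟨0, trivial⟩
  | imp α β iα iβ =>
    obtain ⟨N, hN⟩ := iα
    obtain ⟨M, hM⟩ := iβ
    exact ⟨max N M, hN.mono (le_max_left _ _), hM.mono (le_max_right _ _)⟩
  | box α iα => exact iα

theorem VarsBelow.subst_eq {N : ℕ} {φ : Formula} (hφ : φ.VarsBelow N) (θ : Formula) :
    φ.subst N θ = φ := by
  induction φ with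
  | var p => simp only [subst]; rw [if_neg (Nat.ne_of_lt hφ)]
  | bot => rfl
  | imp α β iα iβ => simp only [subst]; rw [iα hφ.1, iβ hφ.2]
  | box α iα => simp only [subst]; rw [iα hφ]

end Formula

open Formula

theorem sat_subst {X : Type u} (R : X → X → Prop) (V : ℕ → X → Prop) (p : ℕ) (θ φ : Formula)
    (a : X) :
    Sat R V (φ.subst p θ) a ↔ Sat R (Function.update V p (Sat R V θ)) φ a := by
  induction φ generalizing a with
  | var q =>
    by_cases h : q = p
    · subst h; simp [Formula.subst, Sat]
    · simp [Formula.subst, Sat, h]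
  | bot => rfl
  | imp α β iα iβ => simp only [Formula.subst, Sat, iα, iβ]
  | box α iα => simp only [Formula.subst, Sat, iα]

theorem isNormalLogic_valid (F : Frame.{u}) : IsNormalLogic {φ | F.Valid φ} where
  taut _ h V a := h (fun ψ => Sat F.R V ψ a) (fun h => h) fun _ _ => Iff.rfl
  normality _ _ h h' b hb := h b hb (h' b hb)
  mp _ _ h h' V a := h' V a (h V a)
  gen _ h V _ b _ := h V b
  sub _ p θ h V a := (sat_subst F.R V p θ _ a).2 (h _ a)

theorem isNormalLogic_KD45 : IsNormalLogic KD45 where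
  taut φ h := fun _ hL => hL.1.taut φ h
  normality := fun _ hL => hL.1.normality
  mp φ ψ h h' := fun L hL => hL.1.mp φ ψ (h L hL) (h' L hL)
  gen φ h := fun L hL => hL.1.gen φ (h L hL)
  sub φ p θ h := fun L hL => hL.1.sub φ p θ (h L hL)

theorem mem_Fr_KD45_iff (F : Frame.{u}) :
    F ∈ Fr KD45 ↔ F.Serial ∧ F.Transitive ∧ F.Euclidean := by
  constructor
  · intro h
    have hD : F.Valid axD := h _ fun L hL => hL.2.1
    have h4 : F.Valid ax4 := h _ fun L hL => hL.2.2.1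
    have h5 : F.Valid ax5 := h _ fun L hL => hL.2.2.2
    refine ⟨fun a => ?_, fun a b c hab hbc => ?_, fun a b c hab hac => ?_⟩
    -- The correspondence valuations: `p` true everywhere for D, true at the successors of `a` for
    -- 4, true only at `c` for 5.
    · by_contra hn
      push Not at hn
      exact hD (fun _ _ => True) a (fun _ _ => trivial) fun b hb => (hn b hb).elim
    · exact h4 (fun _ x => F.R a x) a (fun _ hx => hx) b hab c hbc
    · by_contra hbc
      exact h5 (fun _ x => x = c) a (fun hn => hn c hac rfl) b hab fun x hx hxc => hbc (hxc ▸ hx)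
  · rintro ⟨hs, ht, he⟩ φ hφ
    refine hφ {φ | F.Valid φ} ⟨isNormalLogic_valid F, ?_, ?_, ?_⟩
    · intro V a h hn
      obtain ⟨b, hb⟩ := hs a
      exact hn b hb (h b hb)
    · exact fun V a h b hb c hc => h c (ht a b c hb hc)
    · exact fun V a h b hb hn => h fun c hc => hn c (he a b c hb hc)

/-! ## Completeness of KD45 for finite cones over clusters -/

/-- Truth values of formulas that respect `→` and `⊥`. -/
structure IsBoolean (t : Formula → Prop) : Prop where
  bot : ¬ t bot
  imp : ∀ α β, t (imp α β) ↔ (t α → t β)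

theorem IsBoolean.neg {t : Formula → Prop} (ht : IsBoolean t) (α : Formula) :
    t (neg α) ↔ ¬ t α :=
  (ht.imp α Formula.bot).trans (imp_congr_right fun _ => iff_false_intro ht.bot)

theorem isBoolean_foldr {t : Formula → Prop} (ht : IsBoolean t) (l : List Formula) (ψ : Formula) :
    t (l.foldr Formula.imp ψ) ↔ ((∀ χ ∈ l, t χ) → t ψ) := by
  induction l with
  | nil => simp
  | cons χ l ih => simp [ht.imp, ih]

/-- A set of formulas that is closed under propositional reasoning. -/
structure IsTheory (D : Set Formula) : Prop where
  taut : ∀ φ : Formula, φ.IsTautology → φ ∈ D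
  mp : ∀ φ ψ : Formula, φ ∈ D → Formula.imp φ ψ ∈ D → ψ ∈ D

theorem IsTheory.of_foldr {D : Set Formula} (hD : IsTheory D) (l : List Formula) (ψ : Formula)
    (hl : ∀ χ ∈ l, χ ∈ D) (h : l.foldr Formula.imp ψ ∈ D) : ψ ∈ D := by
  induction l with
  | nil => exact h
  | cons χ l ih =>
    exact ih (fun χ' h' => hl χ' (List.mem_cons_of_mem _ h'))
      (hD.mp _ _ (hl χ List.mem_cons_self) h)

/-- Lindenbaum's lemma, from the compactness of the Cantor space. -/
theorem IsTheory.exists_isBoolean {D : Set Formula} (hD : IsTheory D) {ψ : Formula} (hψ : ψ ∉ D) :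
    ∃ t : Formula → Prop, IsBoolean t ∧ (∀ χ ∈ D, t χ) ∧ ¬ t ψ := by
  classical
  let C : Set (Formula → Bool) := {t | t bot = false ∧
    (∀ α β, t (imp α β) = (!t α || t β)) ∧ t ψ = false}
  let E : D → Set (Formula → Bool) := fun χ => {t | t χ = true}
  have hC : IsClosed C := by
    refine (isClosed_eq (by fun_prop) (by fun_prop)).inter (IsClosed.inter ?_
      (isClosed_eq (by fun_prop) (by fun_prop)))
    have hI : {t : Formula → Bool | ∀ α β, t (imp α β) = (!t α || t β)} =
        ⋂ α, ⋂ β, {t | t (imp α β) = (!t α || t β)} := by ext; simp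
    change IsClosed {t : Formula → Bool | ∀ α β, t (imp α β) = (!t α || t β)}
    rw [hI]
    refine isClosed_iInter fun α => isClosed_iInter fun β => isClosed_eq (by fun_prop) ?_
    have hc : Continuous fun t : Formula → Bool => (t α, t β) := by fun_prop
    exact (continuous_of_discreteTopology (f := fun p : Bool × Bool => (!p.1 || p.2))).comp hc
  have hE : ∀ χ, IsClosed (E χ) := fun χ => isClosed_eq (by fun_prop) (by fun_prop)
  -- Finite intersection property: if no valuation in `C` satisfied the finite set `u` of members of
  -- `D`, the iterated implication from `u` to `ψ` would be a tautology, and `ψ` would lie in `D`.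
  have key : (C ∩ ⋂ χ, E χ).Nonempty := by
    refine hC.isCompact.inter_iInter_nonempty E hE fun u => ?_
    by_contra hne
    refine hψ (hD.of_foldr (u.toList.map Subtype.val) ψ
      (fun χ h => ?_) (hD.taut _ ?_))
    · obtain ⟨χ', -, rfl⟩ := List.mem_map.1 h
      exact χ'.2
    intro t hb hi
    have ht : IsBoolean t := ⟨hb, hi⟩
    rw [isBoolean_foldr ht]
    intro hl
    by_contra hn
    refine hne ⟨fun χ => decide (t χ), ⟨by simpa using hb, fun α β => ?_, by simpa using hn⟩, ?_⟩
    · rw [Bool.eq_iff_iff]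
      simp [hi, imp_iff_not_or]
    · simp only [Set.mem_iInter]
      intro χ hχ
      have := hl χ (by simpa using hχ)
      simpa [E] using this
  obtain ⟨t, ⟨hb, hi, hn⟩, ht⟩ := key
  refine ⟨fun χ => t χ = true, ⟨by simp [hb], fun α β => ?_⟩, fun χ hχ => ?_, by simp [hn]⟩
  · rw [hi]; cases t α <;> simp
  · exact Set.mem_iInter.1 ht ⟨χ, hχ⟩

/-- Substitution acts on one variable at a time, and `α` may contain the variable 1. So variable 0
is first renamed to a variable `M` that is fresh for `β` and different from 1, then 1 is replaced by
`β`, and finally `M` by `α`. -/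
theorem axK_instance_mem {L : Set Formula} (hL : IsNormalLogic L) (α β : Formula) :
    imp (box (imp α β)) (imp (box α) (box β)) ∈ L := by
  obtain ⟨N, hN⟩ := exists_varsBelow β
  set M := max N 2
  have hM : β.VarsBelow M := hN.mono (le_max_left _ _)
  have hM2 : M ≠ 0 ∧ M ≠ 1 := by
    have : 2 ≤ M := le_max_right _ _
    omega
  have h := hL.sub _ M α (hL.sub _ 1 β (hL.sub _ 0 (var M) hL.normality))
  simpa [axK, Formula.subst, hM2, hM.subst_eq] using h

theorem box_mono_mem {L : Set Formula} (hL : IsNormalLogic L) {α β : Formula}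
    (h : imp α β ∈ L) : imp (box α) (box β) ∈ L :=
  hL.mp _ _ (hL.gen _ h) (axK_instance_mem hL α β)

/-- Truth at a state with valuation `w` whose successors form a cluster with the set of
valuations `T`. -/
def ConeSat (T : Set (ℕ → Prop)) : (ℕ → Prop) → Formula → Prop
  | w, var p => w p
  | _, bot => False
  | w, imp φ ψ => ConeSat T w φ → ConeSat T w ψ
  | _, box φ => ∀ v ∈ T, ConeSat T v φ

/-- Canonical model argument localised at one point. Take `t` containing KD45 and refuting `φ`, and
let `S` be its canonical successors. Axioms 4 and 5 make every member of `S` agree with `t` on boxed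
formulas, so `S` behaves as a cluster; D makes it nonempty. Members of `S` with the same values on
variables may be identified, since the truth lemma only sees those values. -/
theorem exists_not_coneSat {φ : Formula} (hφ : φ ∉ KD45) :
    ∃ (T : Set (ℕ → Prop)) (w : ℕ → Prop), T.Nonempty ∧ ¬ ConeSat T w φ := by
  have hL := isNormalLogic_KD45
  have hD : axD ∈ KD45 := fun L hL => hL.2.1
  have h4 : ax4 ∈ KD45 := fun L hL => hL.2.2.1
  have h5 : ax5 ∈ KD45 := fun L hL => hL.2.2.2
  obtain ⟨t, htb, htL, htφ⟩ := IsTheory.exists_isBoolean ⟨hL.taut, hL.mp⟩ hφ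
  have htD : ∀ θ, t (box θ) → t (dia θ) := fun θ =>
    (htb.imp _ _).1 (htL _ (by simpa [axD, dia, Formula.neg, Formula.subst] using hL.sub _ 0 θ hD))
  have ht4 : ∀ θ, t (box θ) → t (box (box θ)) := fun θ =>
    (htb.imp _ _).1 (htL _ (by simpa [ax4, Formula.subst] using hL.sub _ 0 θ h4))
  have ht5 : ∀ θ, t (dia θ) → t (box (dia θ)) := fun θ =>
    (htb.imp _ _).1 (htL _ (by simpa [ax5, dia, Formula.neg, Formula.subst] using hL.sub _ 0 θ h5))
  have hTh : IsTheory {χ | t (box χ)} :=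
    ⟨fun χ h => htL _ (hL.gen _ (hL.taut _ h)), fun χ ψ h h' =>
      (htb.imp _ _).1 ((htb.imp _ _).1 (htL _ (axK_instance_mem hL χ ψ)) h') h⟩
  have hmono : ∀ {α β : Formula}, imp α β ∈ KD45 → t (box α) → t (box β) := fun h =>
    (htb.imp _ _).1 (htL _ (box_mono_mem hL h))
  let S : Set (Formula → Prop) := {s | IsBoolean s ∧ ∀ χ, t (box χ) → s χ}
  have hbox : ∀ ψ, t (box ψ) ↔ ∀ s ∈ S, s ψ := by
    refine fun ψ => ⟨fun h s hs => hs.2 ψ h, fun h => ?_⟩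
    by_contra hn
    obtain ⟨s, hsb, hs, hsn⟩ := hTh.exists_isBoolean hn
    exact hsn (h s ⟨hsb, hs⟩)
  have hSbox : ∀ s ∈ S, ∀ ψ, s (box ψ) ↔ t (box ψ) := by
    intro s hs ψ
    refine ⟨fun h => ?_, fun h => hs.2 _ (ht4 ψ h)⟩
    by_contra hn
    -- From `¬□ψ` in `t` one gets `◇¬ψ`, by axiom 5 `□◇¬ψ`, and so `□¬□ψ`.
    have hnn : t (box (neg (box ψ))) := by
      have h1 : t (dia (neg ψ)) := by
        rw [dia, htb.neg]
        refine fun h => hn (hmono (hL.taut _ fun r hb hi => ?_) h)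
        have hr : IsBoolean r := ⟨hb, hi⟩
        simp [hr.imp, hr.neg]
      refine hmono (hL.mp _ _ (box_mono_mem hL (α := ψ) (β := neg (neg ψ))
        (hL.taut _ fun r hb hi => ?_)) (hL.taut _ fun r hb hi => ?_)) (ht5 _ h1)
      · have hr : IsBoolean r := ⟨hb, hi⟩
        simp [hr.imp, hr.neg]
      · have hr : IsBoolean r := ⟨hb, hi⟩
        simp only [dia, hr.imp, hr.neg]
        exact fun h h' h'' => h' (h h'')
    exact (hs.1.neg _).1 (hs.2 _ hnn) h
  let val : (Formula → Prop) → ℕ → Prop := fun s p => s (var p)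
  have truth : ∀ ψ, ∀ s, s ∈ S ∨ s = t → (ConeSat (val '' S) (val s) ψ ↔ s ψ) := by
    intro ψ
    induction ψ with
    | var p => exact fun s _ => Iff.rfl
    | bot =>
      rintro s (hs | rfl)
      · exact (iff_false_intro hs.1.bot).symm
      · exact (iff_false_intro htb.bot).symm
    | imp α β iα iβ =>
      intro s hs
      have hsb : IsBoolean s := hs.elim (fun h => h.1) fun h => h ▸ htb
      simp only [ConeSat]
      rw [iα s hs, iβ s hs, hsb.imp]
    | box α iα =>
      intro s hs
      have h1 : s (box α) ↔ t (box α) := hs.elim (fun h => hSbox s h α) fun h => by rw [h]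
      rw [h1, hbox]
      simp only [ConeSat, Set.forall_mem_image]
      exact forall₂_congr fun r hr => iα r (Or.inl hr)
  refine ⟨val '' S, val t, Set.Nonempty.image _ ?_, fun h => htφ ((truth φ t (Or.inr rfl)).1 h)⟩
  by_contra hS
  rw [Set.not_nonempty_iff_eq_empty] at hS
  -- Without successors, `t` contains every boxed formula; D then gives `◇⊥`, which contradicts
  -- `□¬⊥`.
  have hall : ∀ ψ, t (box ψ) := fun ψ => (hbox ψ).2 (by simp [hS])
  exact (htb.neg _).1 (htD bot (hall bot)) (hall _)

/-- Variables that do not occur in `φ` may be made false everywhere. Only finitely many valuations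
then remain, which is the source of the finite model property. -/
theorem coneSat_truncate {N : ℕ} {T : Set (ℕ → Prop)} {φ : Formula} (hφ : φ.VarsBelow N)
    (w : ℕ → Prop) :
    ConeSat ((fun v p => p < N ∧ v p) '' T) (fun p => p < N ∧ w p) φ ↔ ConeSat T w φ := by
  induction φ generalizing w with
  | var p => exact and_iff_right hφ
  | bot => exact Iff.rfl
  | imp α β iα iβ => exact imp_congr (iα hφ.1 w) (iβ hφ.2 w)
  | box α iα =>
    simp only [ConeSat, Set.forall_mem_image]
    exact forall₂_congr fun v _ => iα hφ v

/-- The finite model property of KD45. -/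
theorem exists_finite_not_coneSat {φ : Formula} (hφ : φ ∉ KD45) :
    ∃ (T : Set (ℕ → Prop)) (w : ℕ → Prop), T.Nonempty ∧ T.Finite ∧ ¬ ConeSat T w φ := by
  obtain ⟨T, w, hT, h⟩ := exists_not_coneSat hφ
  obtain ⟨N, hN⟩ := exists_varsBelow φ
  refine ⟨_, _, hT.image _, ?_, fun h' => h ((coneSat_truncate hN w).1 h')⟩
  let ext : (Fin N → Prop) → ℕ → Prop := fun g p => ∃ h : p < N, g ⟨p, h⟩
  refine (Set.finite_range ext).subset ?_
  rintro _ ⟨v, _, rfl⟩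
  exact ⟨fun i => v i, by funext p; simp [ext]⟩

/-- A left inverse of an embedding of `W` into `U`; the value outside `U` is immaterial. It serves
to spread valuations over a cluster, to enumerate small sets and to build p-morphisms. -/
theorem exists_image_eq {α : Type u} {β : Type v} {U : Set α} {W : Set β} (hW : W.Nonempty)
    (hWfin : W.Finite) (hUfin : U.Finite) (h : W.ncard ≤ U.ncard) : ∃ g : α → β, g '' U = W := by
  classical
  have := hWfin.to_subtype
  have := hUfin.to_subtype
  have := hW.to_subtype
  obtain ⟨i⟩ : Nonempty (W ↪ U) := by
    have := Fintype.ofFinite W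
    have := Fintype.ofFinite U
    apply Function.Embedding.nonempty_of_card_le
    rwa [← Nat.card_eq_fintype_card, ← Nat.card_eq_fintype_card]
  refine ⟨fun y => if h : y ∈ U then (Function.invFun i ⟨y, h⟩ : W) else hW.some, ?_⟩
  ext v
  constructor
  · rintro ⟨y, hy, rfl⟩
    simp [hy]
  · intro hv
    exact ⟨i ⟨v, hv⟩, (i ⟨v, hv⟩).2, by simp [Function.leftInverse_invFun i.injective _]⟩

/-- A formula refuted in a cone over a cluster with at most `k` valuations fails at every
irreflexive state with at least `k` successors. -/
theorem not_valid_of_not_coneSat {F : Frame.{u}} (hF : F ∈ Fr KD45) {T : Set (ℕ → Prop)}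
    {w : ℕ → Prop} {φ : Formula} (hT : T.Nonempty) (hfin : T.Finite) (hφ : ¬ ConeSat T w φ)
    {x : F.State} (hx : ¬ F.R x x) (hcard : T.ncard ≤ {y | F.R x y}.ncard) : ¬ F.Valid φ := by
  classical
  obtain ⟨-, ht, he⟩ := (mem_Fr_KD45_iff F).1 hF
  set U := {y | F.R x y} with hU
  have hTpos : 0 < T.ncard := (Set.ncard_pos hfin).2 hT
  have hUfin : U.Finite := Set.finite_of_ncard_pos (hTpos.trans_le hcard)
  obtain ⟨g, hg⟩ := exists_image_eq hT hfin hUfin hcard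
  -- Since `x` is irreflexive, it is not among its own successors, so giving it the valuation `w`
  -- does not disturb the surjection from `U` onto `T`.
  let V : F.State → ℕ → Prop := fun y => if y = x then w else g y
  have hVU : ∀ y ∈ U, V y = g y := fun y hy => if_neg (show ¬ y = x from fun h => hx (show x ∈ U from h ▸ hy))
  have key : ∀ ψ, ∀ y, (y = x ∨ y ∈ U) → (Sat F.R (fun p y => V y p) ψ y ↔ ConeSat T (V y) ψ) := by
    intro ψ
    induction ψ with
    | var p => exact fun _ _ => Iff.rfl
    | bot => exact fun _ _ => Iff.rfl
    | imp α β iα iβ => exact fun y hy => imp_congr (iα y hy) (iβ y hy)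
    | box α iα =>
      intro y hy
      have hR : ∀ z, F.R y z ↔ z ∈ U := by
        rcases hy with rfl | hy
        · exact fun z => Iff.rfl
        · exact fun z => ⟨ht x y z hy, he x y z hy⟩
      simp only [Sat, ConeSat, hR]
      rw [← hg]
      simp only [Set.forall_mem_image]
      refine forall₂_congr fun z hz => ?_
      rw [hg, ← hVU z hz]
      exact iα z (Or.inr hz)
  intro hval
  have := (key φ x (Or.inl rfl)).1 (hval _ x)
  simp only [V, if_pos] at this
  exact hφ this

end ModalRandom

namespace ModalRandom

/-! ## Counting KD45-relations without large irreflexive cones -/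

/-- Serial, transitive and Euclidean relations: every state sees the same states as each of its
successors. -/
def IsKD {α : Type u} (R : α → α → Prop) : Prop :=
  (∀ a, ∃ b, R a b) ∧ ∀ a b, R a b → R b = R a

theorem isKD_iff (F : Frame.{u}) : IsKD F.R ↔ F.Serial ∧ F.Transitive ∧ F.Euclidean := by
  refine and_congr Iff.rfl ⟨fun h => ⟨fun a b c hab hbc => h a b hab ▸ hbc,
    fun a b c hab hac => (h a b hab).symm ▸ hac⟩, fun ⟨ht, he⟩ a b hab => ?_⟩
  ext c
  exact ⟨ht a b c hab, he a b c hab⟩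

/-- Some irreflexive state has at least `k` successors. -/
def HasCone {α : Type u} (k : ℕ) (R : α → α → Prop) : Prop :=
  ∃ x, ¬ R x x ∧ k ≤ {y | R x y}.ncard

/-- Replace the successors of all states in `S` by `W`. -/
def redirect {α : Type u} (R : α → α → Prop) (S W : Set α) : α → α → Prop :=
  fun x y => (x ∈ S ∧ y ∈ W) ∨ (x ∉ S ∧ R x y)

section redirect

variable {α : Type u} {R : α → α → Prop} {S W : Set α}

theorem redirect_of_mem {x : α} (hx : x ∈ S) : redirect R S W x = fun y => y ∈ W := by
  funext y; simp [redirect, hx]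

theorem redirect_of_notMem {x : α} (hx : x ∉ S) : redirect R S W x = R x := by
  funext y; simp [redirect, hx]

/-- The saturation hypothesis says that `S` is a union of components; redirecting fuses them into
one component with final cluster `W` and leaves the others intact. -/
theorem isKD_redirect (hR : IsKD R) (hS : ∀ x ∈ S, ∀ y, R x = R y → y ∈ S) (hW : W.Nonempty)
    (hWS : W ⊆ S) : IsKD (redirect R S W) := by
  refine ⟨fun a => ?_, fun a b hab => ?_⟩
  · by_cases ha : a ∈ S
    · rw [redirect_of_mem ha]; exact hW
    · rw [redirect_of_notMem ha]; exact hR.1 a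
  · by_cases ha : a ∈ S
    · rw [redirect_of_mem ha] at hab ⊢
      rw [redirect_of_mem (hWS hab)]
    · rw [redirect_of_notMem ha] at hab ⊢
      have hba := hR.2 a b hab
      rw [redirect_of_notMem fun hb => ha (hS b hb a hba), hba]

/-- This lets a decoder recover `S` from the altered relation and one known point of `S`. A state
outside `S` cannot see exactly `W`: it shares its row with its successors, which would lie in `S`,
so saturation would put it in `S` as well. -/
theorem redirect_eq_iff (hR : IsKD R) (hS : ∀ x ∈ S, ∀ y, R x = R y → y ∈ S) (hWS : W ⊆ S)
    {s : α} (hs : s ∈ S) : {x | redirect R S W x = redirect R S W s} = S := by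
  ext x
  refine ⟨fun h => ?_, fun h => ?_⟩
  · by_contra hx
    rw [Set.mem_ofPred_eq, redirect_of_mem hs, redirect_of_notMem hx] at h
    obtain ⟨y, hy⟩ := hR.1 x
    have hyW : y ∈ W := by rw [h] at hy; exact hy
    exact hx (hS y (hWS hyW) x (hR.2 x y hy))
  · rw [Set.mem_ofPred_eq, redirect_of_mem hs, redirect_of_mem h]

theorem hasCone_redirect {k : ℕ} {s : α} (hs : s ∈ S) (hsW : s ∉ W) (hk : k ≤ W.ncard) :
    HasCone k (redirect R S W) := by
  refine ⟨s, ?_, ?_⟩ <;> rw [redirect_of_mem hs]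
  · exact hsW
  · exact hk

end redirect

/-- The enumeration depends on the set alone, so encoder and decoder use the same one. -/
theorem exists_range_eq {α : Type u} [Finite α] [Nonempty α] (M : ℕ) :
    ∃ σ : Set α → Fin M → α, ∀ S : Set α, S.Nonempty → S.ncard ≤ M → Set.range (σ S) = S := by
  classical
  have h : ∀ S : Set α, S.Nonempty → S.ncard ≤ M → ∃ g : Fin M → α, Set.range g = S := by
    intro S hne hS
    obtain ⟨g, hg⟩ := exists_image_eq (U := (Set.univ : Set (Fin M))) hne (Set.toFinite _)
      (Set.toFinite _) (by simpa [Set.ncard_univ] using hS)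
    exact ⟨g, by rw [← Set.image_univ, hg]⟩
  obtain ⟨x⟩ := ‹Nonempty α›
  refine ⟨fun S => if hS : S.Nonempty ∧ S.ncard ≤ M then (h S hS.1 hS.2).choose else fun _ => x,
    fun S h1 h2 => ?_⟩
  simp only [h1, h2, and_self, dif_pos]
  exact (h S h1 h2).choose_spec

/-- The data needed to recover a relation without large irreflexive cones from the modified one. -/
abbrev ConeCode (K : ℕ) : Type := (Fin K × Bool) ⊕ (Fin (K * K) → Fin (K * K) → Prop)

/-- For fixed `k`, the relations without a cone over `k` states are outnumbered by those with
one, up to a constant factor. -/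
theorem ncard_not_hasCone_le {α : Type u} [Finite α] {k : ℕ} (hk : 1 ≤ k)
    (e : Fin (2 * k) ↪ α) :
    {R : α → α → Prop | IsKD R ∧ ¬ HasCone k R}.ncard ≤
      {R : α → α → Prop | IsKD R ∧ HasCone k R}.ncard * Nat.card (ConeCode (2 * k)) := by
  classical
  set K := 2 * k with hK
  let z : Fin K := ⟨0, by omega⟩
  have : Nonempty α := ⟨e z⟩
  obtain ⟨σ, hσ⟩ := exists_range_eq (α := α) (K * K)
  let cls : (α → α → Prop) → Fin K → Set α := fun R i => {x | R x = R (e i)}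
  -- The three ways to undo an alteration: turn the component of `e i` back into a full cluster,
  -- complement the cluster within that component, or replay a stored relation on the component of
  -- `e z`.
  let dec : (α → α → Prop) × ConeCode K → α → α → Prop := fun p => match p.2 with
    | Sum.inl (i, true) => redirect p.1 (cls p.1 i) (cls p.1 i)
    | Sum.inl (i, false) => redirect p.1 (cls p.1 i) {y | y ∈ cls p.1 i ∧ ¬ p.1 (e i) y}
    | Sum.inr d => fun x y => (x ∈ cls p.1 z ∧ y ∈ cls p.1 z ∧
        ∃ a b, σ (cls p.1 z) a = x ∧ σ (cls p.1 z) b = y ∧ d a b) ∨ (x ∉ cls p.1 z ∧ p.1 x y)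
  suffices h : {R : α → α → Prop | IsKD R ∧ ¬ HasCone k R} ⊆
      dec '' ({R : α → α → Prop | IsKD R ∧ HasCone k R} ×ˢ Set.univ) by
    calc _ ≤ (dec '' ({R : α → α → Prop | IsKD R ∧ HasCone k R} ×ˢ Set.univ)).ncard :=
          Set.ncard_le_ncard h (Set.toFinite _)
      _ ≤ _ := Set.ncard_image_le (Set.toFinite _)
      _ = _ := by rw [Set.ncard_prod, Set.ncard_univ]
  rintro R ⟨hR, hbad⟩
  have hsat : ∀ i, ∀ x ∈ cls R i, ∀ y, R x = R y → y ∈ cls R i :=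
    fun i x hx y hxy => hxy.symm.trans hx
  have hsub : ∀ i, {y | R (e i) y} ⊆ cls R i := fun i y hy => hR.2 _ _ hy
  by_cases hbig : ∃ i, K ≤ (cls R i).ncard
  · obtain ⟨i, hi⟩ := hbig
    have hmem : e i ∈ cls R i := rfl
    -- If the component is a full cluster, dropping `e i` from the cluster makes `e i` irreflexive
    -- and leaves at least `2 * k - 1 ≥ k` successors.
    by_cases hfull : ∀ x ∈ cls R i, R x x
    · have hall : ∀ x ∈ cls R i, ∀ y, R x y ↔ y ∈ cls R i := fun x hx y =>
        ⟨fun h => (hR.2 x y h).trans hx, fun h => by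
          have := hfull y h
          rwa [h.trans hx.symm] at this⟩
      have hWS : cls R i \ {e i} ⊆ cls R i := Set.sdiff_subset
      have hcard : k ≤ (cls R i \ {e i}).ncard := by
        rw [Set.ncard_sdiff_singleton_of_mem hmem]; omega
      have hne : (cls R i \ {e i}).Nonempty := by
        rw [← Set.ncard_pos]; omega
      have hcls : cls (redirect R (cls R i) (cls R i \ {e i})) i = cls R i :=
        redirect_eq_iff hR (hsat i) hWS hmem
      refine ⟨(redirect R (cls R i) (cls R i \ {e i}), Sum.inl (i, true)),
        ⟨⟨isKD_redirect hR (hsat i) hne hWS, hasCone_redirect hmem (by simp) hcard⟩,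
          Set.mem_univ _⟩, ?_⟩
      funext x
      simp only [dec, hcls]
      by_cases hx : x ∈ cls R i
      · rw [redirect_of_mem hx]
        funext y
        exact propext (hall x hx y).symm
      · rw [redirect_of_notMem hx, redirect_of_notMem hx]
    · push Not at hfull
      obtain ⟨x₀, hx₀, hirr⟩ := hfull
      -- An irreflexive state is present, so the absence of a large cone forces a cluster of fewer
      -- than `k` states. Its complement in the component has more than `k`, and exchanging the two
      -- makes the old cluster irreflexive.
      have hlt : {y | R (e i) y}.ncard < k := by
        by_contra h
        refine hbad ⟨x₀, hirr, ?_⟩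
        rw [show R x₀ = R (e i) from hx₀]
        exact not_lt.1 h
      set W := cls R i \ {y | R (e i) y} with hW
      have hWS : W ⊆ cls R i := Set.sdiff_subset
      have hcard : k ≤ W.ncard := by
        have := Set.ncard_sdiff_add_ncard_of_subset (hsub i)
        rw [← hW] at this
        omega
      have hne : W.Nonempty := by
        rw [← Set.ncard_pos]; omega
      have hcls : cls (redirect R (cls R i) W) i = cls R i :=
        redirect_eq_iff hR (hsat i) hWS hmem
      obtain ⟨y₀, hy₀⟩ := hR.1 (e i)
      refine ⟨(redirect R (cls R i) W, Sum.inl (i, false)),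
        ⟨⟨isKD_redirect hR (hsat i) hne hWS,
          hasCone_redirect (s := y₀) (hsub i hy₀) (fun h => h.2 hy₀) hcard⟩,
          Set.mem_univ _⟩, ?_⟩
      funext x
      simp only [dec, hcls, redirect_of_mem hmem]
      by_cases hx : x ∈ cls R i
      · rw [redirect_of_mem hx, show R x = R (e i) from hx]
        funext y
        simp only [hW, Set.mem_ofPred_eq, Set.mem_sdiff, eq_iff_iff]
        exact ⟨fun h => by_contra fun hn => h.2 ⟨h.1, hn⟩, fun h => ⟨hsub i h, fun h' => h'.2 h⟩⟩
      · rw [redirect_of_notMem hx, redirect_of_notMem hx]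
  · push Not at hbig
    -- All marked components are small. Their union has at least `K` states, enough for a cone after
    -- fusion, and at most `K * K`, so that the original relation on it fits into a code of bounded
    -- size.
    set S : Set α := ⋃ i, cls R i with hSdef
    have hS : ∀ x ∈ S, ∀ y, R x = R y → y ∈ S := by
      intro x hx y hxy
      obtain ⟨i, hi⟩ := Set.mem_iUnion.1 hx
      exact Set.mem_iUnion.2 ⟨i, hsat i x hi y hxy⟩
    have heS : ∀ i, e i ∈ S := fun i => Set.mem_iUnion.2 ⟨i, rfl⟩
    have hle : S.ncard ≤ K * K := by
      calc S.ncard ≤ ∑ i, (cls R i).ncard := by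
            rw [hSdef]
            exact Set.ncard_iUnion_le_of_fintype _
        _ ≤ ∑ _i : Fin K, K := Finset.sum_le_sum fun i _ => (hbig i).le
        _ = K * K := by simp
    have hge : K ≤ S.ncard := by
      calc K = (Set.range e).ncard := by
            rw [← Set.image_univ, Set.ncard_image_of_injective _ e.injective, Set.ncard_univ]
            simp
        _ ≤ S.ncard := Set.ncard_le_ncard (by rintro _ ⟨i, rfl⟩; exact heS i) (Set.toFinite _)
    set W := S \ {e z} with hW
    have hWS : W ⊆ S := Set.sdiff_subset
    have hcard : k ≤ W.ncard := by
      rw [Set.ncard_sdiff_singleton_of_mem (heS z)]; omega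
    have hne : W.Nonempty := by
      rw [← Set.ncard_pos]; omega
    have hcls : cls (redirect R S W) z = S := redirect_eq_iff hR hS hWS (heS z)
    have hr : Set.range (σ S) = S := hσ S ⟨_, heS z⟩ hle
    refine ⟨(redirect R S W, Sum.inr fun a b => R (σ S a) (σ S b)),
      ⟨⟨isKD_redirect hR hS hne hWS, hasCone_redirect (heS z) (by simp [hW]) hcard⟩,
        Set.mem_univ _⟩, ?_⟩
    funext x y
    simp only [dec, hcls, eq_iff_iff]
    by_cases hx : x ∈ S
    · simp only [hx, true_and, not_true_eq_false, false_and, or_false]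
      constructor
      · rintro ⟨-, a, b, rfl, rfl, h⟩
        exact h
      · intro h
        have hy : y ∈ S := hS x hx y (hR.2 x y h).symm
        obtain ⟨a, ha⟩ : x ∈ Set.range (σ S) := hr.symm ▸ hx
        obtain ⟨b, hb⟩ : y ∈ Set.range (σ S) := hr.symm ▸ hy
        exact ⟨hy, a, b, ha, hb, by rwa [ha, hb]⟩
    · simp [hx, redirect_of_notMem]

end ModalRandom

namespace ModalRandom

/-! ## Connected KD45-frames -/

/-- The two ends of an edge have the same successors, so connectedness makes all rows equal.
Conversely, any two states have a common successor in the nonempty final cluster. -/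
theorem connected_iff_eq_finalCluster (F : Frame.{u}) (hF : F.Euclidean) :
    F.Serial ∧ F.Transitive ∧ F.Connected ↔
      (finalCluster F.R).Nonempty ∧ ∀ a b, F.R a b ↔ b ∈ finalCluster F.R := by
  constructor
  · rintro ⟨hs, ht, hc⟩
    obtain ⟨x⟩ := F.nonempty
    obtain ⟨y, hy⟩ := hs x
    have hKD := (isKD_iff F).2 ⟨hs, ht, hF⟩
    have hrow : ∀ a b, F.R a = F.R b := by
      intro a b
      induction hc a b with
      | refl => rfl
      | tail _ h ih =>
        rcases h with h | h
        · exact ih.trans (hKD.2 _ _ h).symm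
        · exact ih.trans (hKD.2 _ _ h)
    refine ⟨⟨y, x, hy⟩, fun a b => ⟨fun h => ⟨a, h⟩, fun ⟨c, h⟩ => ?_⟩⟩
    rw [hrow a c]
    exact h
  · rintro ⟨⟨u, hu⟩, h⟩
    refine ⟨fun a => ⟨u, (h a u).2 hu⟩, fun a b c _ hbc => (h a c).2 ((h b c).1 hbc), fun a b => ?_⟩
    refine Relation.ReflTransGen.tail (b := u) (Relation.ReflTransGen.single ?_) ?_
    · exact Or.inl ((h a u).2 hu)
    · exact Or.inr ((h b u).2 hu)

theorem mem_ConFrames_Fr_KD45_iff (F : Frame.{u}) :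
    F ∈ ConFrames (Fr KD45) ↔
      (finalCluster F.R).Nonempty ∧ ∀ a b, F.R a b ↔ b ∈ finalCluster F.R := by
  constructor
  · rintro ⟨hF, hc⟩
    obtain ⟨hs, ht, he⟩ := (mem_Fr_KD45_iff F).1 hF
    exact (connected_iff_eq_finalCluster F he).1 ⟨hs, ht, hc⟩
  · intro h
    have he : F.Euclidean := fun a b c _ hac => (h.2 b c).2 ((h.2 a c).1 hac)
    obtain ⟨hs, ht, hc⟩ := (connected_iff_eq_finalCluster F he).2 h
    exact ⟨(mem_Fr_KD45_iff F).2 ⟨hs, ht, he⟩, hc⟩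

theorem mem_labelled_iff {n : ℕ} {R : Fin n → Fin n → Prop} :
    R ∈ labelled (ConFrames (Fr KD45)) n ↔
      (finalCluster R).Nonempty ∧ ∀ a b, R a b ↔ b ∈ finalCluster R := by
  constructor
  · rintro ⟨h, hR⟩
    exact (mem_ConFrames_Fr_KD45_iff _).1 hR
  · exact fun h => ⟨⟨h.1.some⟩, (mem_ConFrames_Fr_KD45_iff _).2 h⟩

theorem bijOn_finalCluster (n : ℕ) :
    Set.BijOn (fun R => finalCluster R) (labelled (ConFrames (Fr KD45)) n)
      {U : Set (Fin n) | U.Nonempty} := by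
  refine ⟨fun R hR => (mem_labelled_iff.1 hR).1, fun R hR S hS h => ?_, fun U hU => ?_⟩
  · funext a b
    rw [eq_iff_iff, (mem_labelled_iff.1 hR).2, (mem_labelled_iff.1 hS).2]
    exact Set.ext_iff.1 h b
  · obtain ⟨x, hx⟩ : U.Nonempty := hU
    have hU' : finalCluster (fun _ b : Fin n => b ∈ U) = U :=
      Set.ext fun b => ⟨fun ⟨_, h⟩ => h, fun h => ⟨x, h⟩⟩
    refine ⟨fun _ b => b ∈ U, mem_labelled_iff.2 ?_, hU'⟩
    rw [hU']
    exact ⟨⟨x, hx⟩, fun _ _ => Iff.rfl⟩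

theorem ncard_labelled_connected (n : ℕ) :
    (labelled (ConFrames (Fr KD45)) n).ncard = 2 ^ n - 1 := by
  rw [← (bijOn_finalCluster n).injOn.ncard_image, (bijOn_finalCluster n).image_eq,
    show {U : Set (Fin n) | U.Nonempty} = {∅}ᶜ from
      Set.ext fun U => Set.nonempty_iff_ne_empty, Set.ncard_compl, Set.ncard_singleton]
  simp [Nat.card_eq_fintype_card]

/-! ## Asymptotic probabilities -/

theorem labelled_inter (C A : Set Frame.{0}) (n : ℕ) :
    labelled (C ∩ A) n = labelled C n ∩ labelled A n :=
  Set.ext fun _ => ⟨fun ⟨h, hC, hA⟩ => ⟨⟨h, hC⟩, ⟨h, hA⟩⟩, fun ⟨⟨h, hC⟩, ⟨_, hA⟩⟩ => ⟨h, hC, hA⟩⟩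

theorem labelled_mono {C D : Set Frame.{0}} (h : C ⊆ D) (n : ℕ) : labelled C n ⊆ labelled D n :=
  fun _ ⟨h', hC⟩ => ⟨h', h hC⟩

theorem labelled_ncard_add (C A : Set Frame.{0}) (n : ℕ) :
    (labelled (C ∩ A) n).ncard + (labelled (C \ A) n).ncard = (labelled C n).ncard := by
  have h : labelled (C \ A) n = labelled C n \ labelled (C ∩ A) n :=
    Set.ext fun _ => ⟨fun ⟨h, hC, hA⟩ => ⟨⟨h, hC⟩, fun ⟨_, _, hA'⟩ => hA hA'⟩,
      fun ⟨⟨h, hC⟩, hA⟩ => ⟨h, hC, fun hA' => hA ⟨h, hC, hA'⟩⟩⟩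
  rw [h, add_comm]
  exact Set.ncard_sdiff_add_ncard_of_subset (labelled_mono Set.inter_subset_left n)

theorem prob_le_one (C : Set Frame.{0}) (n : ℕ) (A : Set Frame.{0}) : prob C n A ≤ 1 := by
  refine div_le_one_of_le₀ ?_ (Nat.cast_nonneg _)
  exact_mod_cast Set.ncard_le_ncard (labelled_mono Set.inter_subset_left n) (Set.toFinite _)

theorem AAS.mono {C : Set Frame.{0}} {P Q : ℕ → Set Frame.{0}} (h : AAS C P)
    (hPQ : ∀ n, ∀ R ∈ labelled (C ∩ P n) n, R ∈ labelled (Q n) n) : AAS C Q := by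
  refine tendsto_of_tendsto_of_tendsto_of_le_of_le h tendsto_const_nhds (fun n => ?_)
    fun n => prob_le_one C n (Q n)
  refine div_le_div_of_nonneg_right ?_ (Nat.cast_nonneg _)
  refine Nat.cast_le.2 (Set.ncard_le_ncard (fun R hR => ?_) (Set.toFinite _))
  rw [labelled_inter]
  exact ⟨labelled_mono Set.inter_subset_left n hR, hPQ n R hR⟩

theorem prob_eq_one_sub {C : Set Frame.{0}} {n : ℕ} (h : (labelled C n).ncard ≠ 0)
    (A : Set Frame.{0}) :
    prob C n A = 1 - ((labelled (C \ A) n).ncard : ℝ) / ((labelled C n).ncard : ℝ) := by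
  have h' : ((labelled C n).ncard : ℝ) ≠ 0 := Nat.cast_ne_zero.2 h
  rw [prob, eq_sub_iff_add_eq, ← add_div, ← Nat.cast_add, labelled_ncard_add, div_self h']

/-- A set with at most `r` elements is the range of a partial function from `Fin r`, and each of the
`r` arguments has `n + 1` possible values. -/
theorem ncard_small_sets_le (r n : ℕ) :
    {U : Set (Fin n) | U.ncard ≤ r}.ncard ≤ (n + 1) ^ r := by
  classical
  let g : (Fin r → Option (Fin n)) → Set (Fin n) := fun f => {x | ∃ i, f i = some x}
  have hsub : {U : Set (Fin n) | U.ncard ≤ r} ⊆ Set.range g := by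
    intro U hU
    have hU' : U.ncard ≤ r := hU
    obtain ⟨i⟩ : Nonempty (U ↪ Fin r) := by
      apply Function.Embedding.nonempty_of_card_le
      rwa [← Nat.card_eq_fintype_card, Fintype.card_fin]
    refine ⟨fun j => if h : ∃ x : U, i x = j then some h.choose.1 else none, ?_⟩
    ext x
    constructor
    · rintro ⟨j, hj⟩
      dsimp only at hj
      split_ifs at hj with h
      · rw [← Option.some.inj hj]
        exact h.choose.2
    · intro hx
      have h : ∃ y : U, i y = i ⟨x, hx⟩ := ⟨_, rfl⟩
      refine ⟨i ⟨x, hx⟩, ?_⟩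
      beta_reduce
      rw [dif_pos h, show h.choose = ⟨x, hx⟩ from i.injective h.choose_spec]
  calc _ ≤ (Set.range g).ncard := Set.ncard_le_ncard hsub (Set.toFinite _)
    _ ≤ Nat.card (Fin r → Option (Fin n)) := by
        rw [← Set.image_univ, ← Set.ncard_univ]
        exact Set.ncard_image_le (Set.toFinite _)
    _ = (n + 1) ^ r := by simp

theorem tendsto_poly_div_two_pow (r : ℕ) :
    Tendsto (fun n : ℕ => (((n + 1) ^ r + 1 : ℕ) : ℝ) / ((2 ^ n - 1 : ℕ) : ℝ)) atTop (𝓝 0) := by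
  have h0 : Tendsto (fun n : ℕ => (n : ℝ) ^ r * (1 / 2 : ℝ) ^ n) atTop (𝓝 0) :=
    tendsto_pow_const_mul_const_pow_of_abs_lt_one r (by rw [abs_of_pos] <;> norm_num)
  -- The constant 8 has a factor 2 for the `+ 1` in the numerator, one for the `- 1` in the
  -- denominator, and one for the exponent `n + 1` in place of `n`.
  have h1 := ((tendsto_add_atTop_iff_nat 1).2 h0).const_mul 8
  rw [mul_zero] at h1
  refine squeeze_zero' (Eventually.of_forall fun n => by positivity) ?_ h1
  filter_upwards [eventually_ge_atTop 1] with n hn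
  have hp : (2 : ℕ) ≤ 2 ^ n := Nat.le_self_pow (by omega) 2
  have hpr : (2 : ℝ) ≤ 2 ^ n := by exact_mod_cast hp
  rw [Nat.cast_sub (by omega)]
  push_cast
  rw [div_le_iff₀ (by linarith), pow_succ (1 / 2 : ℝ), one_div, inv_pow]
  have hr : (1 : ℝ) ≤ ((n : ℝ) + 1) ^ r := one_le_pow₀ (by linarith [Nat.cast_nonneg (α := ℝ) n])
  have e : 8 * (((n : ℝ) + 1) ^ r * (((2 : ℝ) ^ n)⁻¹ * 2⁻¹)) * (2 ^ n - 1) =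
      4 * ((n : ℝ) + 1) ^ r * (1 - ((2 : ℝ) ^ n)⁻¹) := by
    field_simp; ring
  rw [e]
  have hi : ((2 : ℝ) ^ n)⁻¹ ≤ 2⁻¹ := inv_anti₀ (by norm_num) hpr
  nlinarith

/-- The final cluster of the random connected KD45-frame is large but not everything. -/
theorem aas_ncard_finalCluster (r : ℕ) :
    AAS (ConFrames (Fr KD45))
      (fun n => {F | r < (finalCluster F.R).ncard ∧ (finalCluster F.R).ncard < n}) := by
  have h : Tendsto (fun n : ℕ => 1 - (((n + 1) ^ r + 1 : ℕ) : ℝ) / ((2 ^ n - 1 : ℕ) : ℝ))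
      atTop (𝓝 1) := by
    simpa using (tendsto_poly_div_two_pow r).const_sub 1
  refine tendsto_of_tendsto_of_tendsto_of_le_of_le' h tendsto_const_nhds ?_
    (Eventually.of_forall fun n => prob_le_one _ n _)
  filter_upwards [eventually_ge_atTop 1] with n hn
  have hp : (2 : ℕ) ≤ 2 ^ n := Nat.le_self_pow (by omega) 2
  rw [prob_eq_one_sub (by rw [ncard_labelled_connected]; omega), ncard_labelled_connected]
  refine sub_le_sub_left (div_le_div_of_nonneg_right (Nat.cast_le.2 ?_) (Nat.cast_nonneg _)) _
  -- The exceptional clusters are the sets of size at most `r` and the whole of `[n]`; the latter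
  -- accounts for the `+ 1` in the bound.
  have hmaps : ∀ R ∈ labelled (ConFrames (Fr KD45) \
      {F | r < (finalCluster F.R).ncard ∧ (finalCluster F.R).ncard < n}) n,
      finalCluster R ∈ insert Set.univ {U : Set (Fin n) | U.ncard ≤ r} := by
    rintro R ⟨_, -, hR⟩
    by_cases hr : (finalCluster R).ncard ≤ r
    · exact Or.inr hr
    · left
      have hge : n ≤ (finalCluster R).ncard := not_lt.1 fun h => hR ⟨not_le.1 hr, h⟩
      refine Set.eq_of_subset_of_ncard_le (Set.subset_univ _) ?_ (Set.toFinite _)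
      rw [Set.ncard_univ]
      simpa using hge
  calc _ ≤ (insert Set.univ {U : Set (Fin n) | U.ncard ≤ r}).ncard :=
        Set.ncard_le_ncard_of_injOn _ hmaps
          ((bijOn_finalCluster n).injOn.mono (labelled_mono Set.sdiff_subset n)) (Set.toFinite _)
    _ ≤ {U : Set (Fin n) | U.ncard ≤ r}.ncard + 1 := Set.ncard_insert_le _ _
    _ ≤ _ := Nat.add_le_add_right (ncard_small_sets_le r n) 1

/-! ## p-morphisms -/

/-- In `G` all states see the same cluster, and at most the root `a` lies outside it. The final
cluster of `F` is mapped onto that cluster and everything else to `a`; properness of the final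
cluster ensures that `a` is attained. -/
theorem exists_pMorphism {F : Frame.{u}} {G : Frame.{v}} (hF : F ∈ ConFrames (Fr KD45))
    [Finite F.State] [Finite G.State] (hG : G ∈ Fr KD45) (hgen : G.PointGenerated)
    (hlarge : Nat.card G.State ≤ (finalCluster F.R).ncard) (hne : finalCluster F.R ≠ Set.univ) :
    ∃ f, F.IsPMorphism G f := by
  classical
  obtain ⟨a, ha⟩ := hgen
  obtain ⟨hs, ht, he⟩ := (mem_Fr_KD45_iff G).1 hG
  have hGKD := (isKD_iff G).2 ⟨hs, ht, he⟩
  have hrow : ∀ b, G.R b = G.R a := by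
    intro b
    induction ha b with
    | refl => rfl
    | tail _ h ih => exact (hGKD.2 _ _ h).trans ih
  have hreach : ∀ b, b = a ∨ G.R a b := by
    intro b
    rcases Relation.ReflTransGen.cases_tail (ha b) with h | ⟨c, -, h⟩
    · exact Or.inl h
    · exact Or.inr (hrow c ▸ h)
  obtain ⟨-, hR⟩ := (mem_ConFrames_Fr_KD45_iff F).1 hF
  obtain ⟨g, hg⟩ := exists_image_eq (U := finalCluster F.R) (W := {y | G.R a y}) (hs a)
    (Set.toFinite _) (Set.toFinite _) ((Set.ncard_le_card _).trans hlarge)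
  let f : F.State → G.State := fun x => if x ∈ finalCluster F.R then g x else a
  have hf : f '' finalCluster F.R = {y | G.R a y} := by
    rw [← hg]
    exact Set.image_congr fun x hx => if_pos hx
  obtain ⟨x₀, hx₀⟩ := (Set.ne_univ_iff_exists_notMem _).1 hne
  refine ⟨f, fun b => ?_, fun x => ?_⟩
  · rcases hreach b with rfl | hb
    · exact ⟨x₀, if_neg hx₀⟩
    · obtain ⟨x, -, hx⟩ : b ∈ f '' finalCluster F.R := hf ▸ hb
      exact ⟨x, hx⟩
  · rw [hrow, ← hf]
    exact congrArg (f '' ·) (Set.ext fun b => (hR x b).symm)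

theorem aas_exists_pMorphism (G : Frame.{v}) (hfin : Finite G.State) (hgen : G.PointGenerated)
    (hG : G ∈ Fr KD45) :
    AAS (ConFrames (Fr KD45)) (fun _ => {F | ∃ f, F.IsPMorphism G f}) := by
  refine (aas_ncard_finalCluster (Nat.card G.State)).mono fun n R => ?_
  rintro ⟨h, hC, hlt, hn⟩
  have : Finite (Frame.State ⟨Fin n, h, R⟩) := inferInstanceAs (Finite (Fin n))
  refine ⟨h, exists_pMorphism hC hG hgen hlt.le fun hu => ?_⟩
  rw [hu, Set.ncard_univ] at hn
  simp at hn

/-! ## The almost sure logic of KD45-frames -/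

theorem labelled_Fr_KD45_nonempty {n : ℕ} (hn : 1 ≤ n) : (labelled (Fr KD45) n).ncard ≠ 0 := by
  refine Nat.pos_iff_ne_zero.1 ((Set.ncard_pos (Set.toFinite _)).2 ?_)
  exact ⟨fun _ _ => True, ⟨⟨0, hn⟩⟩, (mem_Fr_KD45_iff _).2
    ⟨fun a => ⟨a, trivial⟩, fun _ _ _ _ _ => trivial, fun _ _ _ _ _ => trivial⟩⟩

theorem KD45_subset_almostSure : KD45 ⊆ almostSure KD45 := by
  intro φ hφ
  refine tendsto_const_nhds.congr' ?_
  -- For `n = 0` there are no frames and the quotient is `0 / 0 = 0`.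
  filter_upwards [eventually_ge_atTop 1] with n hn
  have hsub : Fr KD45 ⊆ {F : Frame.{0} | F.Valid φ} := fun F hF => hF φ hφ
  rw [prob, Set.inter_eq_left.2 hsub,
    div_self (Nat.cast_ne_zero.2 (labelled_Fr_KD45_nonempty hn))]

theorem almostSure_subset_KD45 : almostSure KD45 ⊆ KD45 := by
  intro φ has
  by_contra hφ
  obtain ⟨T, w, hT, hfin, hTφ⟩ := exists_finite_not_coneSat hφ
  set k := T.ncard
  have hk : 1 ≤ k := (Set.ncard_pos hfin).2 hT
  set M : ℝ := (Nat.card (ConeCode (2 * k)) : ℝ)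
  have hM : 0 ≤ M := Nat.cast_nonneg _
  -- With `A` and `B` the relations with and without a large cone, all frames validating `φ` lie in
  -- `B`, and `|B| ≤ M|A|` gives `|B| / (|A| + |B|) ≤ M / (M + 1) < 1`.
  have hbound : ∀ᶠ n in atTop, prob (Fr KD45) n {F | F.Valid φ} ≤ M / (M + 1) := by
    filter_upwards [eventually_ge_atTop (2 * k)] with n hn
    have hmem : ∀ R : Fin n → Fin n → Prop, R ∈ labelled (Fr KD45) n ↔ IsKD R := by
      have hne : Nonempty (Fin n) := ⟨⟨0, by omega⟩⟩
      refine fun R => ⟨fun ⟨_, h⟩ => (isKD_iff _).2 ((mem_Fr_KD45_iff _).1 h), fun h =>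
        ⟨hne, (mem_Fr_KD45_iff _).2 ((isKD_iff ⟨Fin n, hne, R⟩).1 h)⟩⟩
    have hle := ncard_not_hasCone_le hk (Fin.castLEEmb hn)
    set B := {R : Fin n → Fin n → Prop | IsKD R ∧ ¬ HasCone k R} with hB
    set A := {R : Fin n → Fin n → Prop | IsKD R ∧ HasCone k R} with hA
    have hsum : (labelled (Fr KD45) n).ncard = A.ncard + B.ncard := by
      rw [← Set.ncard_union_eq (Set.disjoint_left.2 fun R h h' => h'.2 h.2)]
      congr 1
      ext R
      rw [hmem]
      by_cases h : HasCone k R <;> simp [hA, hB, h]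
    have hval : (labelled (Fr KD45 ∩ {F | F.Valid φ}) n).ncard ≤ B.ncard := by
      refine Set.ncard_le_ncard (fun R hR => ?_) (Set.toFinite _)
      obtain ⟨h, hF, hv⟩ := hR
      refine ⟨(hmem R).1 ⟨h, hF⟩, ?_⟩
      rintro ⟨x, hx, hc⟩
      exact not_valid_of_not_coneSat (F := ⟨Fin n, h, R⟩) hF hT hfin hTφ hx hc hv
    have hpos : 0 < (labelled (Fr KD45) n).ncard :=
      Nat.pos_of_ne_zero (labelled_Fr_KD45_nonempty (by omega))
    rw [prob, div_le_div_iff₀ (Nat.cast_pos.2 hpos) (by linarith)]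
    have hle' : (B.ncard : ℝ) ≤ A.ncard * M := by
      rw [← Nat.cast_mul]
      exact Nat.cast_le.2 hle
    have hval' : ((labelled (Fr KD45 ∩ {F | F.Valid φ}) n).ncard : ℝ) ≤ B.ncard := by
      exact_mod_cast hval
    rw [hsum]
    push_cast
    nlinarith
  have h1 : (1 : ℝ) ≤ M / (M + 1) := le_of_tendsto has hbound
  rw [le_div_iff₀ (by linarith)] at h1
  linarith

end ModalRandom

theorem theorem3p10 :
    -- the main claim
    almostSure KD45 = KD45 ∧
    -- KD45-frames
    (∀ F : Frame.{u}, F ∈ Fr KD45 ↔ F.Serial ∧ F.Transitive ∧ F.Euclidean) ∧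
    -- a connected KD45-frame is given by its nonempty final cluster
    (∀ F : Frame.{u}, F.Euclidean →
      (F.Serial ∧ F.Transitive ∧ F.Connected ↔
        (finalCluster F.R).Nonempty ∧ ∀ a b, F.R a b ↔ b ∈ finalCluster F.R)) ∧
    (∀ n : ℕ, 1 ≤ n →
      Set.BijOn (fun R => finalCluster R) (labelled (ConFrames (Fr KD45)) n)
        {U : Set (Fin n) | U.Nonempty} ∧
      (labelled (ConFrames (Fr KD45)) n).ncard = 2 ^ n - 1) ∧
    -- the size of the final cluster of the random connected KD45-frame
    (∀ r : ℕ, AAS (ConFrames (Fr KD45))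
      (fun n => {F | r < (finalCluster F.R).ncard ∧ (finalCluster F.R).ncard < n})) ∧
    -- p-morphisms onto finite point-generated KD45-frames
    (∀ G : Frame.{v}, Finite G.State → G.PointGenerated → G ∈ Fr KD45 →
      AAS (ConFrames (Fr KD45)) (fun _ => {F | ∃ f, F.IsPMorphism G f})) := by
  refine ⟨almostSure_subset_KD45.antisymm KD45_subset_almostSure, mem_Fr_KD45_iff,
    connected_iff_eq_finalCluster, fun n _ => ⟨bijOn_finalCluster n, ncard_labelled_connected n⟩,
    aas_ncard_finalCluster, aas_exists_pMorphism⟩
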